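/- Let $x_{ij}$, $i,j=1,2,\dots$, be independent standard Gaussian $N(0,1)$ random variables. For $n\ge m$ and $F\subset\mathbb R$ let $\mathbf M(n,m,F)$ be the set of $n\times m$ matrices with entries in $F$. For $A=(a_{ij})\in\mathbf M(n,m,[0,\infty))$ put $X(A)=(\sqrt{a_{ij}}\,x_{ij})$ and $Z(A)=X(A)^TX(A)$, let $\lambda_i(Z(A))$, $1\le i\le m$, be the eigenvalues of $Z(A)$ counted with multiplicity, and let $\tilde A=A/(n+m)$, so that $X(\tilde A)=(n+m)^{-1/2}X(A)$ and $Z(\tilde A)=(n+m)^{-1}Z(A)$. **Proposition 2.1.** Fix $b<\infty$ and, for each $n$ and $m\le n$, let $\mathcal A_{n,m}\subset\mathbf M(n,m,[0,b])$ be a (possibly empty) class of matrices. Let $\varepsilon_n$, $s_n$ be real sequences with $\varepsilon_n>0$ for all large $n$, $\varepsilon_n\to0$, $s_n\to\infty$ and $s_n\varepsilon_n^2\to\infty$, and assume that for every $\delta>0$ $$\limsup_{n\to\infty}\ \sup_{m\le n,\ A\in\mathcal A_{n,m}}\mathbb P\Big(\frac1{s_n}\sum_{i:\,\lambda_i(Z(\tilde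 A))<\varepsilon_n}\log\frac1{\lambda_i(Z(\tilde A))}>\delta\Big)=0 .$$ Then, for every $\delta>0$, $$\lim_{n\to\infty}\ \sup_{m\le n,\ A\in\mathcal A_{n,m}}\mathbb P\Big(\frac1{s_n}\big|\log\det Z(\tilde A)-\log\mathbb E[\det Z(\tilde A)]\big|>\delta\Big)=0 .$$ Here $\log\frac10=+\infty$, $\log 0=-\infty$, the absolute value in the conclusion is read as $+\infty$ whenever $\det Z(\tilde A)=0$, and a supremum over the empty set is $0$. -/

import Mathlib

open MeasureTheory ProbabilityTheory Filter Topology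

namespace PermanentEstimator

/-- The set `M(n, m, F)` of `n × m` matrices, `m ≤ n`, with entries in `F`. -/
def matrixClass (n m : ℕ) (F : Set ℝ) : Set (Matrix (Fin n) (Fin m) ℝ) :=
  {A | m ≤ n ∧ ∀ i j, A i j ∈ F}

/-- The matrix `X(A) = (√(a i j) * x i j)` built from a realization `x` of the noise. -/
noncomputable def matX {n m : ℕ} (x : ℕ → ℕ → ℝ) (A : Matrix (Fin n) (Fin m) ℝ) :
    Matrix (Fin n) (Fin m) ℝ :=
  Matrix.of fun i j => Real.sqrt (A i j) * x i j

/-- The matrix `Z(A) = X(A)ᵀ X(A)`. -/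
noncomputable def matZ {n m : ℕ} (x : ℕ → ℕ → ℝ) (A : Matrix (Fin n) (Fin m) ℝ) :
    Matrix (Fin m) (Fin m) ℝ :=
  (matX x A).transpose * matX x A

theorem matZ_isHermitian {n m : ℕ} (x : ℕ → ℕ → ℝ) (A : Matrix (Fin n) (Fin m) ℝ) :
    (matZ x A).IsHermitian := by
  simpa [matZ, Matrix.conjTranspose_eq_transpose_of_trivial] using
    Matrix.isHermitian_conjTranspose_mul_self (matX x A)

/-- The eigenvalues of `Z(A)`, with multiplicity. -/
noncomputable def eigZ {n m : ℕ} (x : ℕ → ℕ → ℝ) (A : Matrix (Fin n) (Fin m) ℝ) : Fin m → ℝ :=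
  (matZ_isHermitian x A).eigenvalues

/-- The rescaled matrix, normalized so that `X` of it is `X(A) / √(n + m)`. -/
noncomputable def rescale {n m : ℕ} (A : Matrix (Fin n) (Fin m) ℝ) :
    Matrix (Fin n) (Fin m) ℝ :=
  ((n : ℝ) + (m : ℝ))⁻¹ • A

/-- The logarithm of a nonnegative real as an extended real; `extLog 0 = -∞`. -/
noncomputable def extLog (t : ℝ) : EReal := ENNReal.log (ENNReal.ofReal t)

/-- The sum of `log (1 / λ)` over the eigenvalues `λ < ε` of `Z` of the rescaled matrix; it is
`+∞` as soon as `0` is an eigenvalue (and `ε > 0`). -/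
noncomputable def smallEigSum {n m : ℕ} (x : ℕ → ℕ → ℝ) (A : Matrix (Fin n) (Fin m) ℝ)
    (ε : ℝ) : EReal :=
  ∑ i ∈ Finset.univ.filter (fun i => eigZ x (rescale A) i < ε), -extLog (eigZ x (rescale A) i)

variable {Ω : Type*} [MeasurableSpace Ω]

/-- `E[det Z]` for the rescaled matrix, the expectation of a nonnegative random variable. -/
noncomputable def expDet (P : Measure Ω) (x : ℕ → ℕ → Ω → ℝ) {n m : ℕ}
    (A : Matrix (Fin n) (Fin m) ℝ) : ENNReal :=
  ∫⁻ ω, ENNReal.ofReal (matZ (fun i j => x i j ω) (rescale A)).det ∂P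

/-- `|log det Z - log E[det Z]|` for the rescaled matrix, in `[0, ∞]`. It is `+∞` when
`det Z = 0`, also in the case `E[det Z] = 0`. -/
noncomputable def logDetDeviation (P : Measure Ω) (x : ℕ → ℕ → Ω → ℝ) {n m : ℕ}
    (A : Matrix (Fin n) (Fin m) ℝ) (ω : Ω) : ENNReal :=
  (extLog (matZ (fun i j => x i j ω) (rescale A)).det - ENNReal.log (expDet P x A)).abs

/-- The integrability condition on the small eigenvalues, for the classes `𝒜 n m` and the
sequences `ε`, `s`. The supremum runs over all sizes `m` and all members of `𝒜 n m`. -/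
structure SmallEigCondition (P : Measure Ω) (x : ℕ → ℕ → Ω → ℝ)
    (𝒜 : (n m : ℕ) → Set (Matrix (Fin n) (Fin m) ℝ)) (ε s : ℕ → ℝ) : Prop where
  eps_pos : ∀ᶠ n in atTop, 0 < ε n
  eps_tendsto : Tendsto ε atTop (𝓝 0)
  s_tendsto : Tendsto s atTop atTop
  s_eps_tendsto : Tendsto (fun n => s n * ε n ^ 2) atTop atTop
  limsup_eq : ∀ δ : ℝ, 0 < δ →
    limsup (fun n => ⨆ (m : ℕ) (A ∈ 𝒜 n m),
      P {ω | (δ : EReal) <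
        ((1 / s n : ℝ) : EReal) * smallEigSum (fun i j => x i j ω) A (ε n)}) atTop = 0

end PermanentEstimator

/-!
The logarithm of `det Z` is the trace of `log` of `Z = Xᵀ X`, which is not a Lipschitz function of
the Gaussian noise. Below the level `ε` the logarithm is therefore replaced by its tangent line at
`ε`. The trace `F` of the resulting function `truncLog ε` satisfies `det Z ≤ exp F`, and `F - log
det Z` is at most the sum of `log (1 / λ)` over the eigenvalues `λ < ε`, which is small compared
with `s` by assumption with high probability (`det_le_exp_truncLogDet`,
`exp_truncLogDet_sub_le_det`).

Since `truncLog ε` is concave with derivative `1 / max t ε`, Klein's inequality gives a first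
order upper bound for `F` at a perturbed matrix, and `F` is Lipschitz in the Frobenius norm with
constant `2 √(m / ε)` (`truncLogDet_lipschitz`). In the rescaled noise the constant becomes at
most `2 √(|b| / ε)`, whatever the size of the matrix.

An `L`-Lipschitz function of a standard Gaussian vector satisfies `E[exp F] E[exp (-F)] ≤ exp (L ^
2)` (`exp_mul_exp_neg_lintegral_le_of_lipschitz`). This is a direct consequence of the
Prékopa–Leindler inequality, proved here in dimension one from the Brunn–Minkowski inequality and
tensorized in its Gaussian form. By Markov's inequality `F` is then within `δ s` of `K = log E[exp
F]`, up to a probability of order `exp (4 |b| / ε - δ s)`, which tends to `0` because `s ε → ∞`.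

Finally `E[det Z] ≤ exp K`, and `E[det Z]` is at least half of the value `exp (K - 2 δ s)` that
`det Z` exceeds with probability at least one half. So `log E[det Z]` is within `O(δ s)` of `K` as
well (`meas_logDeviation_le`).
-/

namespace PermanentEstimator

/-! ### The Prékopa–Leindler inequality on the line -/

/-- The translates `K + inf L` and `sup K + L` both lie in `2 • C` and meet only at `sup K + inf
L`. -/
theorem volume_add_volume_le_of_isCompact {K L C : Set ℝ} (hK : IsCompact K) (hL : IsCompact L)
    (hKne : K.Nonempty) (hLne : L.Nonempty) (h : ∀ a ∈ K, ∀ b ∈ L, (a + b) / 2 ∈ C) :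
    volume K + volume L ≤ 2 * volume C := by
  have hK1 := hK.sSup_mem hKne
  have hL1 := hL.sInf_mem hLne
  set a₀ := sSup K
  set b₀ := sInf L
  have e1 : volume ((fun z => z - b₀) ⁻¹' K) = volume K := by
    simpa only [sub_eq_add_neg] using measure_preimage_add_right volume (-b₀) K
  have e2 : volume ((fun z => z - a₀) ⁻¹' L) = volume L := by
    simpa only [sub_eq_add_neg] using measure_preimage_add_right volume (-a₀) L
  have e3 : volume ((fun z => z * (1 / 2 : ℝ)) ⁻¹' C) = 2 * volume C := by
    rw [Real.volume_preimage_mul_right (by norm_num)]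
    norm_num
  have hdisj : AEDisjoint volume ((fun z => z - b₀) ⁻¹' K) ((fun z => z - a₀) ⁻¹' L) := by
    refine measure_mono_null (t := {a₀ + b₀}) ?_ (by simp)
    rintro z ⟨hz1, hz2⟩
    have h1 : z - b₀ ≤ a₀ := le_csSup hK.bddAbove hz1
    have h2 : b₀ ≤ z - a₀ := csInf_le hL.bddBelow hz2
    simp only [Set.mem_singleton_iff]
    linarith
  rw [← e1, ← e2, ← e3, ← measure_union₀ ((measurable_sub_const a₀
    hL.measurableSet).nullMeasurableSet) hdisj]
  refine measure_mono ?_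
  rintro z (hz | hz)
  · have := h _ hz _ hL1
    simp only [Set.mem_preimage]
    convert this using 1
    ring
  · have := h _ hK1 _ hz
    simp only [Set.mem_preimage]
    convert this using 1
    ring

/-- The one-dimensional Brunn–Minkowski inequality, with `C` any set containing all midpoints. -/
theorem volume_add_volume_le {A B C : Set ℝ} (hA : MeasurableSet A) (hB : MeasurableSet B)
    (hAne : A.Nonempty) (hBne : B.Nonempty) (h : ∀ a ∈ A, ∀ b ∈ B, (a + b) / 2 ∈ C) :
    volume A + volume B ≤ 2 * volume C := by
  obtain ⟨a, ha⟩ := hAne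
  obtain ⟨b, hb⟩ := hBne
  -- A point of `A` and a point of `B` are adjoined because the inner approximations may be empty.
  have key : ∀ K ⊆ A, IsCompact K → ∀ L ⊆ B, IsCompact L →
      volume K + volume L ≤ 2 * volume C := by
    intro K hKA hK L hLB hL
    calc volume K + volume L ≤ volume (insert a K) + volume (insert b L) := by
          gcongr <;> exact Set.subset_insert _ _
      _ ≤ _ := volume_add_volume_le_of_isCompact (hK.insert a) (hL.insert b)
          (Set.insert_nonempty _ _) (Set.insert_nonempty _ _)
          (fun x hx y hy => h x (Set.insert_subset ha hKA hx) y (Set.insert_subset hb hLB hy))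
  rw [hA.measure_eq_iSup_isCompact, hB.measure_eq_iSup_isCompact]
  simp_rw [iSup_and']
  exact ENNReal.biSup_add_biSup_le' ⟨∅, Set.empty_subset _, isCompact_empty⟩
    ⟨∅, Set.empty_subset _, isCompact_empty⟩ fun K hK L hL => key K hK.1 hK.2 L hL.1 hL.2

/-- The Prékopa–Leindler inequality for functions with supremum `1`: the Brunn–Minkowski
inequality applied to superlevel sets, integrated over the level. The normalization makes the
superlevel sets of `f` and `g` nonempty for exactly the same levels. -/
theorem lintegral_add_lintegral_le_of_sup_eq_one {f g h : ℝ → ℝ} (hf : Measurable f)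
    (hg : Measurable g) (hh : Measurable h) (hf0 : ∀ x, 0 ≤ f x) (hg0 : ∀ x, 0 ≤ g x)
    (hh0 : ∀ x, 0 ≤ h x) (hf1 : ∀ x, f x ≤ 1) (hg1 : ∀ x, g x ≤ 1)
    (hfs : ∀ t < 1, ∃ x, t < f x) (hgs : ∀ t < 1, ∃ x, t < g x)
    (H : ∀ x y, f x * g y ≤ h ((x + y) / 2) ^ 2) :
    (∫⁻ x, ENNReal.ofReal (f x)) + ∫⁻ x, ENNReal.ofReal (g x) ≤
      2 * ∫⁻ x, ENNReal.ofReal (h x) := by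
  have anti : ∀ u : ℝ → ℝ, Measurable fun t : ℝ => volume {x | t < u x} := fun u =>
    Antitone.measurable fun s t hst => measure_mono fun x (hx : t < u x) => lt_of_le_of_lt hst hx
  rw [lintegral_eq_lintegral_meas_lt volume (ae_of_all _ hf0) hf.aemeasurable,
    lintegral_eq_lintegral_meas_lt volume (ae_of_all _ hg0) hg.aemeasurable,
    lintegral_eq_lintegral_meas_lt volume (ae_of_all _ hh0) hh.aemeasurable,
    ← lintegral_add_left (anti f), ← lintegral_const_mul _ (anti h)]
  refine setLIntegral_mono' measurableSet_Ioi fun t (ht : 0 < t) => ?_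
  rcases lt_or_ge t 1 with h1 | h1
  · refine volume_add_volume_le (measurableSet_lt measurable_const hf)
      (measurableSet_lt measurable_const hg) (hfs t h1) (hgs t h1) ?_
    intro x (hx : t < f x) y (hy : t < g y)
    refine lt_of_pow_lt_pow_left₀ 2 (hh0 _) (lt_of_lt_of_le ?_ (H x y))
    nlinarith
  · have e1 : {x | t < f x} = ∅ := Set.eq_empty_of_forall_notMem fun x (hx : t < f x) =>
      absurd (hf1 x) (by linarith)
    have e2 : {x | t < g x} = ∅ := Set.eq_empty_of_forall_notMem fun x (hx : t < g x) =>
      absurd (hg1 x) (by linarith)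
    simp [e1, e2]

theorem four_mul_le_add_sq_ennreal (u v : ENNReal) : 4 * (u * v) ≤ (u + v) ^ 2 := by
  induction u with
  | top => simp
  | coe u =>
    induction v with
    | top => simp
    | coe v =>
      norm_cast
      rw [← NNReal.coe_le_coe]
      push_cast
      nlinarith [sq_nonneg ((u : ℝ) - v)]

theorem lintegral_mul_lintegral_le_sq_of_bddAbove {f g h : ℝ → ℝ} (hf : Measurable f)
    (hg : Measurable g) (hh : Measurable h) (hf0 : ∀ x, 0 ≤ f x) (hg0 : ∀ x, 0 ≤ g x)
    (hh0 : ∀ x, 0 ≤ h x) (hfb : BddAbove (Set.range f)) (hgb : BddAbove (Set.range g))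
    (H : ∀ x y, f x * g y ≤ h ((x + y) / 2) ^ 2) :
    (∫⁻ x, ENNReal.ofReal (f x)) * ∫⁻ x, ENNReal.ofReal (g x) ≤
      (∫⁻ x, ENNReal.ofReal (h x)) ^ 2 := by
  set a := ⨆ x, f x with ha
  set b := ⨆ x, g x with hb
  have hfa : ∀ x, f x ≤ a := fun x => le_ciSup hfb x
  have hgb' : ∀ x, g x ≤ b := fun x => le_ciSup hgb x
  rcases eq_or_lt_of_le ((hf0 0).trans (hfa 0)) with h0 | ha0
  · have : ∀ x, f x = 0 := fun x => le_antisymm ((hfa x).trans h0.symm.le) (hf0 x)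
    simp [this]
  rcases eq_or_lt_of_le ((hg0 0).trans (hgb' 0)) with h0 | hb0
  · have : ∀ x, g x = 0 := fun x => le_antisymm ((hgb' x).trans h0.symm.le) (hg0 x)
    simp [this]
  have hc0 : 0 < Real.sqrt (a * b) := by positivity
  have key := lintegral_add_lintegral_le_of_sup_eq_one (f := fun x => a⁻¹ * f x)
    (g := fun x => b⁻¹ * g x) (h := fun x => (Real.sqrt (a * b))⁻¹ * h x)
    (by fun_prop) (by fun_prop) (by fun_prop)
    (fun x => mul_nonneg (by positivity) (hf0 x)) (fun x => mul_nonneg (by positivity) (hg0 x))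
    (fun x => mul_nonneg (by positivity) (hh0 x))
    (fun x => by rw [inv_mul_le_iff₀ ha0]; simpa using hfa x)
    (fun x => by rw [inv_mul_le_iff₀ hb0]; simpa using hgb' x)
    (fun t ht => by
      obtain ⟨x, hx⟩ := exists_lt_of_lt_ciSup (show a * t < ⨆ x, f x by nlinarith)
      exact ⟨x, by rwa [lt_inv_mul_iff₀ ha0]⟩)
    (fun t ht => by
      obtain ⟨x, hx⟩ := exists_lt_of_lt_ciSup (show b * t < ⨆ x, g x by nlinarith)
      exact ⟨x, by rwa [lt_inv_mul_iff₀ hb0]⟩)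
    (fun x y => by
      rw [mul_pow, inv_pow, Real.sq_sqrt (by positivity), mul_inv]
      calc a⁻¹ * f x * (b⁻¹ * g y) = a⁻¹ * b⁻¹ * (f x * g y) := by ring
        _ ≤ _ := by gcongr; exact H x y)
  have pull : ∀ (c : ℝ) (u : ℝ → ℝ), 0 < c → (∫⁻ x, ENNReal.ofReal (c⁻¹ * u x)) =
      (ENNReal.ofReal c)⁻¹ * ∫⁻ x, ENNReal.ofReal (u x) := by
    intro c u hc
    rw [← lintegral_const_mul' _ _ (by simpa using hc)]
    refine lintegral_congr fun x => ?_
    rw [ENNReal.ofReal_mul (by positivity), ENNReal.ofReal_inv_of_pos hc]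
  rw [pull a f ha0, pull b g hb0, pull _ h hc0] at key
  set If := ∫⁻ x, ENNReal.ofReal (f x)
  set Ig := ∫⁻ x, ENNReal.ofReal (g x)
  set Ih := ∫⁻ x, ENNReal.ofReal (h x)
  have h2 := (four_mul_le_add_sq_ennreal ((ENNReal.ofReal a)⁻¹ * If)
    ((ENNReal.ofReal b)⁻¹ * Ig)).trans (pow_le_pow_left' key 2)
  set A := ENNReal.ofReal a with hA
  set B := ENNReal.ofReal b with hB
  set S := ENNReal.ofReal (Real.sqrt (a * b)) with hS
  have hSS : S ^ 2 = A * B := by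
    rw [hS, ← ENNReal.ofReal_pow hc0.le, Real.sq_sqrt (by positivity), ENNReal.ofReal_mul ha0.le]
  have hA0 : A ≠ 0 := by simpa [hA] using ha0
  have hB0 : B ≠ 0 := by simpa [hB] using hb0
  have hAt : A ≠ ⊤ := ENNReal.ofReal_ne_top
  have hBt : B ≠ ⊤ := ENNReal.ofReal_ne_top
  have h3 : 4 * (A * B)⁻¹ * (If * Ig) ≤ 4 * (A * B)⁻¹ * Ih ^ 2 := by
    calc 4 * (A * B)⁻¹ * (If * Ig) = 4 * (A⁻¹ * If * (B⁻¹ * Ig)) := by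
          rw [ENNReal.mul_inv (Or.inl hA0) (Or.inl hAt)]; ring
      _ ≤ (2 * (S⁻¹ * Ih)) ^ 2 := h2
      _ = 4 * (A * B)⁻¹ * Ih ^ 2 := by
          rw [← hSS, mul_pow, mul_pow, ENNReal.inv_pow]; norm_num; ring
  refine (ENNReal.mul_le_mul_iff_right ?_ ?_).1 h3
  · simp [ENNReal.mul_eq_top, hA0, hB0, hAt, hBt]
  · simp [ENNReal.mul_eq_top, hA0, hB0, hAt, hBt]

theorem iSup_lintegral_min_natCast {f : ℝ → ENNReal} (hf : Measurable f) :
    ⨆ k : ℕ, ∫⁻ x, min (f x) k = ∫⁻ x, f x := by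
  rw [← lintegral_iSup (fun k => hf.min measurable_const)
    (fun i j hij x => min_le_min_left _ (by exact_mod_cast hij))]
  refine lintegral_congr fun x => ?_
  have := inf_iSup_eq (f x) (fun k : ℕ => (k : ENNReal))
  rw [ENNReal.iSup_natCast] at this
  simpa using this.symm

/-- The one-dimensional Prékopa–Leindler inequality at the midpoint. -/
theorem lintegral_mul_lintegral_le_sq {f g : ℝ → ENNReal} {h : ℝ → ℝ} (hf : Measurable f)
    (hg : Measurable g) (hh : Measurable h) (hh0 : ∀ x, 0 ≤ h x)
    (H : ∀ x y, f x * g y ≤ ENNReal.ofReal (h ((x + y) / 2) ^ 2)) :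
    (∫⁻ x, f x) * ∫⁻ x, g x ≤ (∫⁻ x, ENNReal.ofReal (h x)) ^ 2 := by
  have ntop : ∀ (u : ENNReal) (k : ℕ), min u k ≠ ⊤ := fun u k =>
    ne_top_of_le_ne_top (ENNReal.natCast_ne_top k) (min_le_right _ _)
  rw [← iSup_lintegral_min_natCast hf, ← iSup_lintegral_min_natCast hg]
  simp_rw [ENNReal.iSup_mul, ENNReal.mul_iSup]
  refine iSup_le fun k => iSup_le fun l => ?_
  have bdd : ∀ (u : ℝ → ENNReal) (k : ℕ), BddAbove (Set.range fun x => (min (u x) k).toReal) := by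
    rintro u k
    refine ⟨k, ?_⟩
    rintro _ ⟨x, rfl⟩
    simpa using ENNReal.toReal_mono (ENNReal.natCast_ne_top k) (min_le_right (u x) k)
  have := lintegral_mul_lintegral_le_sq_of_bddAbove
    (f := fun x => (min (f x) k).toReal) (g := fun x => (min (g x) l).toReal) (h := h)
    (hf.min measurable_const).ennreal_toReal (hg.min measurable_const).ennreal_toReal hh
    (fun x => ENNReal.toReal_nonneg) (fun x => ENNReal.toReal_nonneg) hh0 (bdd f k) (bdd g l)
    (fun x y => by
      rw [← ENNReal.toReal_mul]
      exact ENNReal.toReal_le_of_le_ofReal (by positivity)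
        ((mul_le_mul' (min_le_left _ _) (min_le_left _ _)).trans (H x y)))
  simpa only [ENNReal.ofReal_toReal (ntop _ _)] using this

/-! ### Gaussian concentration -/

/-- The Prékopa–Leindler inequality with respect to the standard Gaussian law. The parallelogram
identity turns the product of two Gaussian densities into the squared density at the midpoint, at
the price of the factor `exp ((x - y) ^ 2 / 4)`. -/
theorem gaussianReal_lintegral_mul_le {f g : ℝ → ENNReal} (hf : Measurable f) (hg : Measurable g)
    {C : ℝ} (hC : 0 ≤ C)
    (H : ∀ x y, f x * g y ≤ ENNReal.ofReal (C * Real.exp ((x - y) ^ 2 / 4))) :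
    (∫⁻ x, f x ∂gaussianReal 0 1) * ∫⁻ x, g x ∂gaussianReal 0 1 ≤ ENNReal.ofReal C := by
  have hm : Measurable (gaussianPDF 0 1) := measurable_gaussianPDF 0 1
  rw [gaussianReal_of_var_ne_zero 0 one_ne_zero, lintegral_withDensity_eq_lintegral_mul _ hm hf,
    lintegral_withDensity_eq_lintegral_mul _ hm hg]
  have hpos := fun x => gaussianPDFReal_nonneg 0 1 x
  have key := lintegral_mul_lintegral_le_sq (f := gaussianPDF 0 1 * f) (g := gaussianPDF 0 1 * g)
    (h := fun x => Real.sqrt C * gaussianPDFReal 0 1 x) (hm.mul hf) (hm.mul hg)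
    ((measurable_gaussianPDFReal 0 1).const_mul _)
    (fun x => mul_nonneg (Real.sqrt_nonneg _) (hpos x))
    (fun x y => by
      have e : gaussianPDFReal 0 1 x * gaussianPDFReal 0 1 y * Real.exp ((x - y) ^ 2 / 4) =
          gaussianPDFReal 0 1 ((x + y) / 2) ^ 2 := by
        simp only [gaussianPDFReal_def]
        rw [mul_mul_mul_comm, mul_assoc, ← Real.exp_add, ← Real.exp_add, mul_pow, sq (Real.exp _),
          ← Real.exp_add, ← sq]
        congr 2
        simp
        ring
      calc (gaussianPDF 0 1 * f) x * (gaussianPDF 0 1 * g) y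
          = gaussianPDF 0 1 x * gaussianPDF 0 1 y * (f x * g y) := by simp; ring
        _ ≤ gaussianPDF 0 1 x * gaussianPDF 0 1 y *
            ENNReal.ofReal (C * Real.exp ((x - y) ^ 2 / 4)) := by gcongr; exact H x y
        _ = _ := by
          simp only [gaussianPDF]
          rw [← ENNReal.ofReal_mul (hpos x), ← ENNReal.ofReal_mul (mul_nonneg (hpos x) (hpos y)),
            mul_pow, Real.sq_sqrt hC, ← e]
          congr 1
          ring)
  refine key.trans ?_
  simp_rw [ENNReal.ofReal_mul (Real.sqrt_nonneg C)]
  rw [lintegral_const_mul _ (by fun_prop), lintegral_gaussianPDFReal_eq_one 0 one_ne_zero, mul_one,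
    ← ENNReal.ofReal_pow (Real.sqrt_nonneg C), Real.sq_sqrt hC]

/-- Tensorization: for fixed first coordinates `s`, `t`, the inductive hypothesis applies to the
slices with constant `C * exp ((s - t) ^ 2 / 4)`, so the partial integrals satisfy the
one-dimensional hypothesis with constant `C`. -/
theorem gaussian_pi_fin_lintegral_mul_le (N : ℕ) {f g : (Fin N → ℝ) → ENNReal} (hf : Measurable f)
    (hg : Measurable g) {C : ℝ} (hC : 0 ≤ C)
    (H : ∀ x y, f x * g y ≤ ENNReal.ofReal (C * Real.exp ((∑ i, (x i - y i) ^ 2) / 4))) :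
    (∫⁻ x, f x ∂Measure.pi fun _ => gaussianReal 0 1) *
      ∫⁻ x, g x ∂(Measure.pi fun _ => gaussianReal 0 1) ≤ ENNReal.ofReal C := by
  induction N generalizing C with
  | zero =>
    rw [Measure.pi_of_empty, lintegral_dirac, lintegral_dirac]
    simpa using H isEmptyElim isEmptyElim
  | succ N ih =>
    have mp := (measurePreserving_piFinSuccAbove
      (fun _ : Fin (N + 1) => gaussianReal 0 1) 0).symm
    have split : ∀ u : (Fin (N + 1) → ℝ) → ENNReal, Measurable u →
        Measurable (fun s : ℝ => ∫⁻ x, u (Fin.cons s x)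
          ∂Measure.pi fun _ : Fin N => gaussianReal 0 1) ∧
        (∀ s : ℝ, Measurable fun x : Fin N → ℝ => u (Fin.cons s x)) ∧
        ∫⁻ x, u x ∂(Measure.pi fun _ : Fin (N + 1) => gaussianReal 0 1) =
        ∫⁻ s, ∫⁻ x, u (Fin.cons s x) ∂(Measure.pi fun _ : Fin N => gaussianReal 0 1)
          ∂gaussianReal 0 1 := by
      intro u hu
      have hu' : Measurable fun p : ℝ × (Fin N → ℝ) => u (Fin.cons p.1 p.2) := by
        have := hu.comp mp.measurable
        simpa [MeasurableEquiv.piFinSuccAbove, Function.comp_def, Fin.consEquiv] using this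
      refine ⟨hu'.lintegral_prod_right', fun s => hu'.comp measurable_prodMk_left, ?_⟩
      rw [← mp.lintegral_comp hu, ← lintegral_prod _ hu'.aemeasurable]
      simp [MeasurableEquiv.piFinSuccAbove, Fin.consEquiv]
    obtain ⟨mf, mf', ef⟩ := split f hf
    obtain ⟨mg, mg', eg⟩ := split g hg
    rw [ef, eg]
    refine gaussianReal_lintegral_mul_le mf mg hC fun s t => ?_
    refine ih (mf' s) (mg' t) (by positivity) fun x y => (H _ _).trans_eq ?_
    congr 1
    rw [mul_assoc, ← Real.exp_add, Fin.sum_univ_succ]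
    simp only [Fin.cons_zero, Fin.cons_succ]
    ring_nf

theorem gaussian_pi_lintegral_mul_le {ι : Type*} [Fintype ι] {f g : (ι → ℝ) → ENNReal}
    (hf : Measurable f) (hg : Measurable g) {C : ℝ} (hC : 0 ≤ C)
    (H : ∀ x y, f x * g y ≤ ENNReal.ofReal (C * Real.exp ((∑ i, (x i - y i) ^ 2) / 4))) :
    (∫⁻ x, f x ∂Measure.pi fun _ => gaussianReal 0 1) *
      ∫⁻ x, g x ∂(Measure.pi fun _ => gaussianReal 0 1) ≤ ENNReal.ofReal C := by
  let e := (Fintype.equivFin ι).symm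
  have mp := measurePreserving_piCongrLeft (fun _ : ι => gaussianReal 0 1) e
  rw [← mp.lintegral_comp hf, ← mp.lintegral_comp hg]
  refine gaussian_pi_fin_lintegral_mul_le _ (hf.comp mp.measurable) (hg.comp mp.measurable) hC
    fun x y => (H _ _).trans_eq ?_
  rw [← Equiv.sum_comp e]
  simp [MeasurableEquiv.coe_piCongrLeft]

/-- Dimension-free exponential concentration of an `L`-Lipschitz function of a standard Gaussian
vector, in a form that needs no centering. It follows from `L d ≤ L ^ 2 + d ^ 2 / 4`. -/
theorem exp_mul_exp_neg_lintegral_le_of_lipschitz {ι : Type*} [Fintype ι] {F : (ι → ℝ) → ℝ}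
    (hF : Measurable F) {L : ℝ}
    (H : ∀ x y, F x - F y ≤ L * Real.sqrt (∑ i, (x i - y i) ^ 2)) :
    (∫⁻ x, ENNReal.ofReal (Real.exp (F x)) ∂Measure.pi fun _ => gaussianReal 0 1) *
      ∫⁻ x, ENNReal.ofReal (Real.exp (-F x)) ∂(Measure.pi fun _ => gaussianReal 0 1) ≤
        ENNReal.ofReal (Real.exp (L ^ 2)) := by
  refine gaussian_pi_lintegral_mul_le (by fun_prop) (by fun_prop) (Real.exp_nonneg _) fun x y => ?_
  rw [← ENNReal.ofReal_mul (Real.exp_nonneg _), ← Real.exp_add, ← Real.exp_add]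
  refine ENNReal.ofReal_le_ofReal (Real.exp_le_exp.2 ?_)
  have h0 : 0 ≤ ∑ i, (x i - y i) ^ 2 := Finset.sum_nonneg fun i _ => sq_nonneg _
  have := H x y
  have hs := Real.sq_sqrt h0
  nlinarith [sq_nonneg (L - Real.sqrt (∑ i, (x i - y i) ^ 2) / 2)]

/-! ### Klein's inequality for the truncated logarithm -/

/-- The logarithm on `[ε, ∞)`, continued to the left of `ε` by its tangent line at `ε`. The
function is concave, bounds the logarithm from above, and has derivative `1 / max t ε`. -/
noncomputable def truncLog (ε t : ℝ) : ℝ :=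
  if ε ≤ t then Real.log t else Real.log ε - 1 + t / ε

theorem truncLog_eq (ε r : ℝ) (hε : 0 < ε) :
    truncLog ε r = r / max r ε - 1 + Real.log (max r ε) := by
  unfold truncLog
  split_ifs with h
  · have : r ≠ 0 := by linarith
    rw [max_eq_left h, div_self this]
    ring
  · rw [max_eq_right (not_le.1 h).le]
    ring

/-- The tangent line of `log` at any `v ≥ ε` lies above `truncLog ε`. -/
theorem truncLog_le_tangent {ε v : ℝ} (hε : 0 < ε) (hv : ε ≤ v) (t : ℝ) :
    truncLog ε t ≤ t / v - 1 + Real.log v := by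
  have hv0 : 0 < v := hε.trans_le hv
  unfold truncLog
  split_ifs with h
  · have ht : 0 < t := hε.trans_le h
    have := Real.log_le_sub_one_of_pos (div_pos ht hv0)
    rw [Real.log_div ht.ne' hv0.ne'] at this
    linarith
  · have h1 := Real.log_le_sub_one_of_pos (div_pos hε hv0)
    rw [Real.log_div hε.ne' hv0.ne'] at h1
    have h2 : 0 ≤ (1 - t / ε) * (1 - ε / v) :=
      mul_nonneg (sub_nonneg.2 ((div_le_one hε).2 (not_le.1 h).le))
        (sub_nonneg.2 ((div_le_one hv0).2 hv))
    have h3 : t / ε * (ε / v) = t / v := by field_simp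
    linarith [show (1 - t / ε) * (1 - ε / v) = 1 - t / ε - ε / v + t / ε * (ε / v) by ring]

theorem truncLog_le_add {ε : ℝ} (hε : 0 < ε) (r t : ℝ) :
    truncLog ε t ≤ truncLog ε r + (max r ε)⁻¹ * (t - r) := by
  rw [truncLog_eq ε r hε]
  refine (truncLog_le_tangent hε (le_max_right r ε) t).trans_eq ?_
  ring

theorem log_le_truncLog {ε t : ℝ} (hε : 0 < ε) (ht : 0 < t) : Real.log t ≤ truncLog ε t := by
  unfold truncLog
  split_ifs with h
  · rfl
  · have := Real.log_le_sub_one_of_pos (div_pos ht hε)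
    rw [Real.log_div ht.ne' hε.ne'] at this
    linarith

theorem truncLog_nonpos {ε t : ℝ} (hε : 0 < ε) (hε1 : ε ≤ 1) (ht : t < ε) :
    truncLog ε t ≤ 0 := by
  rw [truncLog, if_neg (not_le.2 ht)]
  linarith [Real.log_nonpos hε.le hε1, (div_lt_one hε).2 ht]

section Klein

variable {ι : Type*} [Fintype ι] [DecidableEq ι]

theorem inner_toEuclideanLin_self {T : Matrix ι ι ℝ} (hT : T.IsHermitian)
    (v : EuclideanSpace ℝ ι) :
    inner ℝ v (T.toEuclideanLin v) =
      ∑ k, hT.eigenvalues k * inner ℝ v (hT.eigenvectorBasis k) ^ 2 := by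
  rw [← hT.eigenvectorBasis.sum_inner_mul_inner]
  refine Finset.sum_congr rfl fun k _ => ?_
  have h1 : T.toEuclideanLin (hT.eigenvectorBasis k) =
      hT.eigenvalues k • hT.eigenvectorBasis k := by
    ext i
    simpa using congrFun (hT.mulVec_eigenvectorBasis k) i
  rw [← (Matrix.isSymmetric_toEuclideanLin_iff.2 hT) _ _, h1, inner_smul_left, real_inner_comm v]
  simp
  ring

/-- Klein's inequality for the trace of `truncLog ε`: the squared inner products of the two
eigenbases form a doubly stochastic matrix, against which the tangent inequality is averaged. -/
theorem sum_truncLog_eigenvalues_le {ε : ℝ} (hε : 0 < ε) {S T : Matrix ι ι ℝ}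
    (hS : S.IsHermitian) (hT : T.IsHermitian) :
    ∑ k, truncLog ε (hT.eigenvalues k) ≤ ∑ i, (truncLog ε (hS.eigenvalues i) +
      (max (hS.eigenvalues i) ε)⁻¹ *
        (inner ℝ (hS.eigenvectorBasis i) (T.toEuclideanLin (hS.eigenvectorBasis i)) -
          hS.eigenvalues i)) := by
  set e := hS.eigenvectorBasis
  set f := hT.eigenvectorBasis
  have hrow : ∀ i, ∑ k, inner ℝ (e i) (f k) ^ 2 = 1 := fun i => by
    rw [show ∑ k, inner ℝ (e i) (f k) ^ 2 = ∑ k, inner ℝ (e i) (f k) * inner ℝ (f k) (e i) from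
      Finset.sum_congr rfl fun k _ => by rw [real_inner_comm (e i), sq], f.sum_inner_mul_inner]
    simp
  have hcol : ∀ k, ∑ i, inner ℝ (e i) (f k) ^ 2 = 1 := fun k => by
    rw [show ∑ i, inner ℝ (e i) (f k) ^ 2 = ∑ i, inner ℝ (f k) (e i) * inner ℝ (e i) (f k) from
      Finset.sum_congr rfl fun i _ => by rw [real_inner_comm (e i), sq], e.sum_inner_mul_inner]
    simp
  calc ∑ k, truncLog ε (hT.eigenvalues k)
      = ∑ k, ∑ i, inner ℝ (e i) (f k) ^ 2 * truncLog ε (hT.eigenvalues k) := by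
        simp_rw [← Finset.sum_mul, hcol, one_mul]
    _ ≤ ∑ k, ∑ i, inner ℝ (e i) (f k) ^ 2 * (truncLog ε (hS.eigenvalues i) +
          (max (hS.eigenvalues i) ε)⁻¹ * (hT.eigenvalues k - hS.eigenvalues i)) := by
        gcongr with k _ i _
        exact truncLog_le_add hε _ _
    _ = _ := by
        rw [Finset.sum_comm]
        refine Finset.sum_congr rfl fun i _ => ?_
        rw [inner_toEuclideanLin_self hT]
        set A := truncLog ε (hS.eigenvalues i)
        set d := (max (hS.eigenvalues i) ε)⁻¹
        calc ∑ k, inner ℝ (e i) (f k) ^ 2 * (A + d * (hT.eigenvalues k - hS.eigenvalues i))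
            = (∑ k, inner ℝ (e i) (f k) ^ 2) * A +
              d * (∑ k, hT.eigenvalues k * inner ℝ (e i) (f k) ^ 2 -
                (∑ k, inner ℝ (e i) (f k) ^ 2) * hS.eigenvalues i) := by
              rw [Finset.sum_mul, Finset.sum_mul, ← Finset.sum_sub_distrib, Finset.mul_sum,
                ← Finset.sum_add_distrib]
              exact Finset.sum_congr rfl fun k _ => by ring
          _ = _ := by rw [hrow, one_mul, one_mul]

end Klein

/-! ### Lipschitz bound for the truncated log-determinant -/

theorem isHermitian_transpose_mul_self {n m : ℕ} (M : Matrix (Fin n) (Fin m) ℝ) :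
    (M.transpose * M).IsHermitian := by
  simpa [Matrix.conjTranspose_eq_transpose_of_trivial] using
    Matrix.isHermitian_conjTranspose_mul_self M

/-- The trace of `truncLog ε` of `Mᵀ M`, a Lipschitz substitute for `log det (Mᵀ M)`. -/
noncomputable def truncLogDet {n m : ℕ} (ε : ℝ) (M : Matrix (Fin n) (Fin m) ℝ) : ℝ :=
  ∑ i, truncLog ε ((isHermitian_transpose_mul_self M).eigenvalues i)

theorem inner_toEuclideanLin_transpose_mul_self {n m : ℕ} (M : Matrix (Fin n) (Fin m) ℝ)
    (v : EuclideanSpace ℝ (Fin m)) :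
    inner ℝ v ((M.transpose * M).toEuclideanLin v) = ‖M.toEuclideanLin v‖ ^ 2 := by
  rw [← real_inner_self_eq_norm_sq]
  simp only [EuclideanSpace.inner_eq_star_dotProduct, star_trivial, Matrix.ofLp_toLpLin,
    Matrix.toLin'_apply, Matrix.toLin'_mul, LinearMap.comp_apply]
  rw [Matrix.mulVec_transpose, ← Matrix.dotProduct_mulVec]

theorem eigenvalues_transpose_mul_self {n m : ℕ} (M : Matrix (Fin n) (Fin m) ℝ) (i : Fin m) :
    (isHermitian_transpose_mul_self M).eigenvalues i =
      ‖M.toEuclideanLin ((isHermitian_transpose_mul_self M).eigenvectorBasis i)‖ ^ 2 := by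
  set h := isHermitian_transpose_mul_self M
  have h1 : (M.transpose * M).toEuclideanLin (h.eigenvectorBasis i) =
      h.eigenvalues i • h.eigenvectorBasis i := by
    ext j
    simpa using congrFun (h.mulVec_eigenvectorBasis i) j
  rw [← inner_toEuclideanLin_transpose_mul_self, h1, inner_smul_right]
  simp

theorem sum_norm_toEuclideanLin_sq {n m : ℕ} (H : Matrix (Fin n) (Fin m) ℝ)
    (e : OrthonormalBasis (Fin m) ℝ (EuclideanSpace ℝ (Fin m))) :
    ∑ i, ‖H.toEuclideanLin (e i)‖ ^ 2 = ∑ a, ∑ j, H a j ^ 2 := by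
  simp_rw [EuclideanSpace.norm_sq_eq]
  rw [Finset.sum_comm]
  refine Finset.sum_congr rfl fun a _ => ?_
  have h1 := e.sum_inner_mul_inner (WithLp.toLp 2 (H a)) (WithLp.toLp 2 (H a))
  rw [real_inner_self_eq_norm_sq, EuclideanSpace.norm_sq_eq] at h1
  simp only [Real.norm_eq_abs, sq_abs] at h1 ⊢
  rw [← h1]
  refine Finset.sum_congr rfl fun i _ => ?_
  rw [real_inner_comm _ (e i), ← sq]
  simp [EuclideanSpace.inner_eq_star_dotProduct, Matrix.mulVec, dotProduct_comm]

/-- A semiconcavity estimate. It is Klein's inequality at `Mᵀ M` together with the bound `1 / √ε`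
for `‖M e‖ / max (‖M e‖ ^ 2) ε`, summed over the eigenvectors `e` by the Cauchy–Schwarz
inequality. -/
theorem truncLogDet_add_le {n m : ℕ} {ε : ℝ} (hε : 0 < ε) (M H : Matrix (Fin n) (Fin m) ℝ) :
    truncLogDet ε (M + H) - truncLogDet ε M ≤
      2 * Real.sqrt (m / ε) * Real.sqrt (∑ a, ∑ j, H a j ^ 2) + (∑ a, ∑ j, H a j ^ 2) / ε := by
  set hM := isHermitian_transpose_mul_self M
  set e := hM.eigenvectorBasis with he
  have key := sum_truncLog_eigenvalues_le hε hM (isHermitian_transpose_mul_self (M + H))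
  rw [Finset.sum_add_distrib] at key
  have hterm : ∀ i, (max (hM.eigenvalues i) ε)⁻¹ *
      (inner ℝ (e i) (((M + H).transpose * (M + H)).toEuclideanLin (e i)) - hM.eigenvalues i) ≤
      2 / Real.sqrt ε * ‖H.toEuclideanLin (e i)‖ + ‖H.toEuclideanLin (e i)‖ ^ 2 / ε := by
    intro i
    rw [inner_toEuclideanLin_transpose_mul_self, eigenvalues_transpose_mul_self M i, ← he, map_add,
      LinearMap.add_apply]
    set p := M.toEuclideanLin (e i)
    set q := H.toEuclideanLin (e i)
    have hs : 0 < Real.sqrt ε := Real.sqrt_pos.2 hε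
    have hss : Real.sqrt ε ^ 2 = ε := Real.sq_sqrt hε.le
    set D := max (‖p‖ ^ 2) ε
    have hD1 : ‖p‖ ^ 2 ≤ D := le_max_left _ _
    have hD2 : ε ≤ D := le_max_right _ _
    have hD0 : 0 < D := hε.trans_le hD2
    have h1 : ‖p + q‖ ^ 2 - ‖p‖ ^ 2 ≤ 2 * ‖p‖ * ‖q‖ + ‖q‖ ^ 2 := by
      have := norm_add_le p q
      nlinarith [norm_nonneg (p + q), norm_nonneg p, norm_nonneg q]
    have h2 : ‖p‖ * D⁻¹ ≤ 1 / Real.sqrt ε := by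
      rw [← div_eq_mul_inv, div_le_div_iff₀ hD0 hs]
      nlinarith [sq_nonneg (‖p‖ - Real.sqrt ε)]
    have h3 : D⁻¹ ≤ ε⁻¹ := inv_anti₀ hε hD2
    calc D⁻¹ * (‖p + q‖ ^ 2 - ‖p‖ ^ 2) ≤ D⁻¹ * (2 * ‖p‖ * ‖q‖ + ‖q‖ ^ 2) := by gcongr
      _ = 2 * (‖p‖ * D⁻¹) * ‖q‖ + D⁻¹ * ‖q‖ ^ 2 := by ring
      _ ≤ 2 * (1 / Real.sqrt ε) * ‖q‖ + ε⁻¹ * ‖q‖ ^ 2 := by gcongr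
      _ = _ := by ring
  have hsum := sum_norm_toEuclideanLin_sq H e
  have hcs : ∑ i, ‖H.toEuclideanLin (e i)‖ ≤
      Real.sqrt m * Real.sqrt (∑ a, ∑ j, H a j ^ 2) := by
    rw [← hsum, ← Real.sqrt_mul (Nat.cast_nonneg m)]
    refine Real.le_sqrt_of_sq_le ?_
    simpa using sq_sum_le_card_mul_sum_sq (s := Finset.univ)
      (f := fun i => ‖H.toEuclideanLin (e i)‖)
  have h4 := Finset.sum_le_sum fun i (_ : i ∈ Finset.univ) => hterm i
  rw [Finset.sum_add_distrib, ← Finset.mul_sum, ← Finset.sum_div, hsum] at h4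
  have h5 : 2 / Real.sqrt ε * ∑ i, ‖H.toEuclideanLin (e i)‖ ≤
      2 * Real.sqrt (m / ε) * Real.sqrt (∑ a, ∑ j, H a j ^ 2) := by
    rw [Real.sqrt_div (Nat.cast_nonneg m)]
    calc _ ≤ 2 / Real.sqrt ε * (Real.sqrt m * Real.sqrt (∑ a, ∑ j, H a j ^ 2)) := by gcongr
      _ = _ := by ring
  unfold truncLogDet
  linarith

/-- A quadratic error in a Lipschitz estimate disappears upon subdivision of the segment from `x`
to `y`. -/
theorem sub_le_mul_norm_of_le_add_sq {V : Type*} [NormedAddCommGroup V] [NormedSpace ℝ V]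
    {φ : V → ℝ} {a c : ℝ} (h : ∀ x y, φ y - φ x ≤ a * ‖y - x‖ + c * ‖y - x‖ ^ 2) (x y : V) :
    φ y - φ x ≤ a * ‖y - x‖ := by
  have step : ∀ k : ℕ, φ y - φ x ≤ a * ‖y - x‖ + c * ‖y - x‖ ^ 2 * (1 / ((k : ℝ) + 1)) := by
    intro k
    have hk : (0 : ℝ) < (k : ℝ) + 1 := by positivity
    set p : ℕ → V := fun j => x + ((j : ℝ) / (k + 1)) • (y - x) with hp
    have h0 : p 0 = x := by simp [hp]
    have h1 : p (k + 1) = y := by simp [hp, div_self hk.ne']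
    have hd : ∀ j, ‖p (j + 1) - p j‖ = ‖y - x‖ / (k + 1) := by
      intro j
      have : p (j + 1) - p j = (1 / ((k : ℝ) + 1)) • (y - x) := by
        simp only [hp, Nat.cast_add, Nat.cast_one, add_sub_add_left_eq_sub, ← sub_smul]
        congr 1
        ring
      rw [this, norm_smul, Real.norm_of_nonneg (by positivity)]
      ring
    calc φ y - φ x = ∑ j ∈ Finset.range (k + 1), (φ (p (j + 1)) - φ (p j)) := by
          rw [Finset.sum_range_sub (fun j => φ (p j)), h0, h1]
      _ ≤ ∑ j ∈ Finset.range (k + 1), (a * (‖y - x‖ / (k + 1)) + c * (‖y - x‖ / (k + 1)) ^ 2) := by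
          refine Finset.sum_le_sum fun j _ => ?_
          rw [← hd j]
          exact h _ _
      _ = _ := by
          rw [Finset.sum_const, Finset.card_range, nsmul_eq_mul]
          push_cast
          field_simp
  have lim : Tendsto (fun k : ℕ => a * ‖y - x‖ + c * ‖y - x‖ ^ 2 * (1 / ((k : ℝ) + 1))) atTop
      (𝓝 (a * ‖y - x‖)) := by
    simpa using (tendsto_one_div_add_atTop_nhds_zero_nat.const_mul
      (c * ‖y - x‖ ^ 2)).const_add (a * ‖y - x‖)
  exact ge_of_tendsto' lim step

/-- The Lipschitz bound for `truncLogDet` as a function of the noise, for weights `w i j` of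
square at most `β`. -/
theorem truncLogDet_lipschitz {n m : ℕ} {ε β : ℝ} (hε : 0 < ε) (hβ : 0 ≤ β)
    {w : Fin n → Fin m → ℝ} (hw : ∀ i j, w i j ^ 2 ≤ β) (x y : Fin n × Fin m → ℝ) :
    truncLogDet ε (Matrix.of fun i j => w i j * y (i, j)) -
      truncLogDet ε (Matrix.of fun i j => w i j * x (i, j)) ≤
      2 * Real.sqrt (m / ε * β) * Real.sqrt (∑ p, (y p - x p) ^ 2) := by
  have := sub_le_mul_norm_of_le_add_sq (V := EuclideanSpace ℝ (Fin n × Fin m))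
    (φ := fun z => truncLogDet ε (Matrix.of fun i j => w i j * z (i, j)))
    (a := 2 * Real.sqrt (m / ε * β)) (c := β / ε) (fun x y => ?_) (WithLp.toLp 2 x)
    (WithLp.toLp 2 y)
  · simpa [EuclideanSpace.norm_eq] using this
  · set H : Matrix (Fin n) (Fin m) ℝ := Matrix.of fun i j => w i j * (y (i, j) - x (i, j)) with hH
    have e : (Matrix.of fun i j => w i j * y (i, j)) =
        (Matrix.of fun i j => w i j * x (i, j)) + H := by
      ext i j
      simp [hH]
      ring
    have hsum : ∑ a, ∑ j, H a j ^ 2 ≤ β * ‖y - x‖ ^ 2 := by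
      rw [EuclideanSpace.norm_sq_eq, Fintype.sum_prod_type, Finset.mul_sum]
      refine Finset.sum_le_sum fun i _ => ?_
      rw [Finset.mul_sum]
      refine Finset.sum_le_sum fun j _ => ?_
      simp only [hH, Matrix.of_apply, mul_pow, PiLp.sub_apply, Real.norm_eq_abs, sq_abs]
      exact mul_le_mul_of_nonneg_right (hw i j) (sq_nonneg _)
    have hsq : Real.sqrt (∑ a, ∑ j, H a j ^ 2) ≤ Real.sqrt β * ‖y - x‖ := by
      refine (Real.sqrt_le_sqrt hsum).trans_eq ?_
      rw [Real.sqrt_mul hβ, Real.sqrt_sq (norm_nonneg _)]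
    simp only [e]
    refine (truncLogDet_add_le hε _ H).trans ?_
    rw [Real.sqrt_mul (by positivity)]
    calc _ ≤ 2 * Real.sqrt (m / ε) * (Real.sqrt β * ‖y - x‖) + β * ‖y - x‖ ^ 2 / ε := by gcongr
      _ = _ := by ring

/-! ### Comparison of the truncated log-determinant with the determinant -/

theorem eigenvalues_transpose_mul_self_nonneg {n m : ℕ} (M : Matrix (Fin n) (Fin m) ℝ)
    (i : Fin m) : 0 ≤ (isHermitian_transpose_mul_self M).eigenvalues i := by
  rw [eigenvalues_transpose_mul_self]
  positivity

theorem det_transpose_mul_self_eq_prod {n m : ℕ} (M : Matrix (Fin n) (Fin m) ℝ) :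
    (M.transpose * M).det = ∏ i, (isHermitian_transpose_mul_self M).eigenvalues i := by
  simpa using (isHermitian_transpose_mul_self M).det_eq_prod_eigenvalues

theorem det_le_exp_truncLogDet {n m : ℕ} {ε : ℝ} (hε : 0 < ε) (M : Matrix (Fin n) (Fin m) ℝ) :
    (M.transpose * M).det ≤ Real.exp (truncLogDet ε M) := by
  rw [det_transpose_mul_self_eq_prod, truncLogDet, Real.exp_sum]
  refine Finset.prod_le_prod (fun i _ => eigenvalues_transpose_mul_self_nonneg M i) fun i _ => ?_
  rcases (eigenvalues_transpose_mul_self_nonneg M i).eq_or_lt with h | h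
  · rw [← h]
    exact Real.exp_nonneg _
  · rw [← Real.log_le_iff_le_exp h]
    exact log_le_truncLog hε h

theorem extLog_of_pos {t : ℝ} (ht : 0 < t) : extLog t = Real.log t :=
  ENNReal.log_ofReal_of_pos ht

theorem ereal_coe_sum {ι : Type*} (S : Finset ι) (f : ι → ℝ) :
    ((∑ i ∈ S, f i : ℝ) : EReal) = ∑ i ∈ S, (f i : EReal) := by
  classical
  induction S using Finset.induction_on with
  | empty => simp
  | insert i S hi ih => rw [Finset.sum_insert hi, Finset.sum_insert hi, EReal.coe_add, ih]

/-- Where the small eigenvalues contribute at most `r`, the truncation changes `log det` by at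
most `r`; in particular no eigenvalue vanishes there. -/
theorem exp_truncLogDet_sub_le_det {n m : ℕ} {ε r : ℝ} (hε : 0 < ε) (hε1 : ε ≤ 1)
    {x : ℕ → ℕ → ℝ} {A : Matrix (Fin n) (Fin m) ℝ} (h : smallEigSum x A ε ≤ (r : EReal)) :
    Real.exp (truncLogDet ε (matX x (rescale A)) - r) ≤ (matZ x (rescale A)).det := by
  set lam : Fin m → ℝ := eigZ x (rescale A) with hlam
  have h0 : ∀ i, 0 ≤ lam i := fun i =>
    eigenvalues_transpose_mul_self_nonneg (matX x (rescale A)) i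
  have hterm : ∀ i ∈ Finset.univ.filter (fun i => lam i < ε), 0 ≤ -extLog (lam i) := by
    intro i hi
    have h2 : ENNReal.ofReal (lam i) ≤ 1 := by
      rw [ENNReal.ofReal_le_one]
      exact ((Finset.mem_filter.1 hi).2.trans_le hε1).le
    rw [extLog, EReal.neg_nonneg]
    exact ENNReal.log_le_zero_iff.2 h2
  have hpos : ∀ i, 0 < lam i := by
    intro i
    refine (h0 i).lt_of_ne' fun hi => ?_
    have hmem : i ∈ Finset.univ.filter (fun i => lam i < ε) := by simp [hi, hε]
    have h3 : -extLog (lam i) ≤ smallEigSum x A ε := Finset.single_le_sum hterm hmem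
    have h4 : -extLog (lam i) = ⊤ := by simp [extLog, hi]
    rw [h4] at h3
    exact absurd (h3.trans h) (by simp)
  have hsum : smallEigSum x A ε =
      ((∑ i ∈ Finset.univ.filter (fun i => lam i < ε), -Real.log (lam i) : ℝ) : EReal) := by
    rw [smallEigSum, ereal_coe_sum]
    refine Finset.sum_congr rfl fun i _ => ?_
    rw [← hlam, extLog_of_pos (hpos i), EReal.coe_neg]
  rw [hsum, EReal.coe_le_coe_iff] at h
  have hdet : (matZ x (rescale A)).det = Real.exp (∑ i, Real.log (lam i)) := by
    rw [Real.exp_sum]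
    refine (det_transpose_mul_self_eq_prod (matX x (rescale A))).trans ?_
    exact Finset.prod_congr rfl fun i _ => (Real.exp_log (hpos i)).symm
  rw [hdet]
  refine Real.exp_le_exp.2 ?_
  have h5 : truncLogDet ε (matX x (rescale A)) ≤ ∑ i, (Real.log (lam i) +
      if lam i < ε then -Real.log (lam i) else 0) := by
    refine Finset.sum_le_sum fun i _ => ?_
    change truncLog ε (lam i) ≤ _
    split_ifs with hi
    -- For `λ < ε ≤ 1` the summand is `log λ - log λ = 0`, which dominates `truncLog ε λ`.
    · simpa using truncLog_nonpos hε hε1 hi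
    · simp [truncLog, not_lt.1 hi]
  rw [Finset.sum_add_distrib, ← Finset.sum_filter] at h5
  linarith

/-! ### The Gaussian noise matrix -/

theorem continuous_of_sub_le_mul_sqrt {ι : Type*} [Fintype ι] {F : (ι → ℝ) → ℝ} {L : ℝ}
    (H : ∀ x y, F y - F x ≤ L * Real.sqrt (∑ i, (y i - x i) ^ 2)) : Continuous F := by
  refine continuous_iff_continuousAt.2 fun x => tendsto_iff_dist_tendsto_zero.2 ?_
  have hc : Tendsto (fun y : ι → ℝ => L * Real.sqrt (∑ i, (y i - x i) ^ 2)) (𝓝 x) (𝓝 0) := by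
    have : Continuous fun y : ι → ℝ => L * Real.sqrt (∑ i, (y i - x i) ^ 2) := by fun_prop
    simpa using this.tendsto x
  refine squeeze_zero (fun _ => dist_nonneg) (fun y => ?_) hc
  rw [Real.dist_eq, abs_le]
  have h1 := H y x
  have h2 : ∑ i, (x i - y i) ^ 2 = ∑ i, (y i - x i) ^ 2 :=
    Finset.sum_congr rfl fun i _ => by ring
  rw [h2] at h1
  exact ⟨by linarith, H x y⟩

section Noise

variable {Ω : Type*} [MeasurableSpace Ω] {P : Measure Ω} {x : ℕ → ℕ → Ω → ℝ}

theorem aemeasurable_noise (hlaw : ∀ i j, HasLaw (x i j) (gaussianReal 0 1) P) (n m : ℕ) :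
    AEMeasurable (fun ω (p : Fin n × Fin m) => x p.1 p.2 ω) P :=
  aemeasurable_pi_lambda _ fun p => (hlaw p.1 p.2).aemeasurable

/-- The noise entering an `n × m` matrix is a standard Gaussian vector. -/
theorem map_noise [IsProbabilityMeasure P] (hlaw : ∀ i j, HasLaw (x i j) (gaussianReal 0 1) P)
    (hindep : iIndepFun (fun (p : ℕ × ℕ) => x p.1 p.2) P) (n m : ℕ) :
    P.map (fun ω (p : Fin n × Fin m) => x p.1 p.2 ω) =
      Measure.pi fun _ => gaussianReal 0 1 := by
  have hinj : Function.Injective fun p : Fin n × Fin m => ((p.1 : ℕ), (p.2 : ℕ)) := by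
    rintro ⟨i, j⟩ ⟨k, l⟩ h
    simp only [Prod.mk.injEq] at h
    exact Prod.ext (Fin.ext h.1) (Fin.ext h.2)
  have h1 := hindep.precomp hinj
  have h2 := (iIndepFun_iff_map_fun_eq_pi_map
    (fun p : Fin n × Fin m => (hlaw p.1 p.2).aemeasurable)).1 h1
  simp only [(hlaw _ _).map_eq] at h2
  exact h2

theorem aemeasurable_det_matZ (hlaw : ∀ i j, HasLaw (x i j) (gaussianReal 0 1) P) {n m : ℕ}
    (A : Matrix (Fin n) (Fin m) ℝ) :
    AEMeasurable (fun ω => (matZ (fun i j => x i j ω) A).det) P := by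
  have hc : Continuous fun z : Fin n × Fin m → ℝ =>
      ((Matrix.of fun i j => Real.sqrt (A i j) * z (i, j)).transpose *
        (Matrix.of fun i j => Real.sqrt (A i j) * z (i, j))).det := by
    have : Continuous fun z : Fin n × Fin m → ℝ =>
      (Matrix.of fun i j => Real.sqrt (A i j) * z (i, j)) :=
      continuous_matrix fun i j => by simpa using by fun_prop
    exact (this.matrix_transpose.matrix_mul this).matrix_det
  have := hc.measurable.comp_aemeasurable (aemeasurable_noise hlaw n m)
  simp only [Function.comp_def] at this
  exact this

theorem sq_sqrt_rescale_le {n m : ℕ} {b : ℝ} {A : Matrix (Fin n) (Fin m) ℝ}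
    (hA : A ∈ matrixClass n m (Set.Icc 0 b)) (i : Fin n) (j : Fin m) :
    Real.sqrt (rescale A i j) ^ 2 ≤ |b| / ((n : ℝ) + m) := by
  have h := hA.2 i j
  have h1 : 0 ≤ ((n : ℝ) + m)⁻¹ := by positivity
  simp only [rescale, Matrix.smul_apply, smul_eq_mul]
  rw [Real.sq_sqrt (mul_nonneg h1 h.1), div_eq_inv_mul]
  exact mul_le_mul_of_nonneg_left (h.2.trans (le_abs_self b)) h1

/-- The exponential moment bound for the truncated log-determinant. The factor `m / (n + m) ≤ 1`
from the rescaling makes it independent of the size of the matrix. -/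
theorem truncLogDet_exp_moment [IsProbabilityMeasure P]
    (hlaw : ∀ i j, HasLaw (x i j) (gaussianReal 0 1) P)
    (hindep : iIndepFun (fun (p : ℕ × ℕ) => x p.1 p.2) P) {n m : ℕ} {b ε : ℝ} (hε : 0 < ε)
    {A : Matrix (Fin n) (Fin m) ℝ} (hA : A ∈ matrixClass n m (Set.Icc 0 b)) :
    AEMeasurable (fun ω => truncLogDet ε (matX (fun i j => x i j ω) (rescale A))) P ∧
    (∫⁻ ω, ENNReal.ofReal (Real.exp (truncLogDet ε (matX (fun i j => x i j ω) (rescale A)))) ∂P) *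
      ∫⁻ ω, ENNReal.ofReal (Real.exp (-truncLogDet ε (matX (fun i j => x i j ω) (rescale A)))) ∂P
      ≤ ENNReal.ofReal (Real.exp (4 * |b| / ε)) := by
  set G : (Fin n × Fin m → ℝ) → ℝ := fun z =>
    truncLogDet ε (Matrix.of fun i j => Real.sqrt (rescale A i j) * z (i, j)) with hG
  set β := |b| / ((n : ℝ) + m) with hβ
  have hβ0 : 0 ≤ β := by positivity
  have hlip := truncLogDet_lipschitz (n := n) (m := m) hε hβ0 (sq_sqrt_rescale_le hA)
  change ∀ x y, G y - G x ≤ _ at hlip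
  have hGm : Measurable G := (continuous_of_sub_le_mul_sqrt hlip).measurable
  have hX := aemeasurable_noise hlaw n m
  -- Both sides unfold to the same matrix: the weights are the square roots of the entries.
  have hGX : ∀ ω, truncLogDet ε (matX (fun i j => x i j ω) (rescale A)) =
      G (fun p : Fin n × Fin m => x p.1 p.2 ω) := fun ω => rfl
  have hlin : ∀ U : (Fin n × Fin m → ℝ) → ENNReal, Measurable U →
      ∫⁻ ω, U (fun p => x p.1 p.2 ω) ∂P =
      ∫⁻ z, U z ∂(Measure.pi fun _ => gaussianReal 0 1) := by
    intro U hU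
    rw [← map_noise hlaw hindep n m, lintegral_map' hU.aemeasurable hX]
  simp only [hGX]
  -- Unification would otherwise unfold the eigenvalues inside `G`.
  clear_value G
  refine ⟨hGm.comp_aemeasurable hX, ?_⟩
  rw [hlin (fun z => ENNReal.ofReal (Real.exp (G z))) (by fun_prop),
    hlin (fun z => ENNReal.ofReal (Real.exp (-G z))) (by fun_prop)]
  refine (exp_mul_exp_neg_lintegral_le_of_lipschitz hGm fun x y => hlip y x).trans ?_
  refine ENNReal.ofReal_le_ofReal (Real.exp_le_exp.2 ?_)
  rw [mul_pow, Real.sq_sqrt (by positivity), hβ]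
  have h1 : (m : ℝ) / ((n : ℝ) + m) ≤ 1 := div_le_one_of_le₀ (by simp) (by positivity)
  calc 2 ^ 2 * (↑m / ε * (|b| / (↑n + ↑m))) = 4 * |b| / ε * (m / ((n : ℝ) + m)) := by ring
    _ ≤ 4 * |b| / ε * 1 := by gcongr
    _ = _ := mul_one _

end Noise

/-! ### Concentration of the log-determinant -/

/-- The probabilistic core: if `D ≤ exp F`, if `D ≥ exp (F - t)` off `Bad`, and if `F`
concentrates, then `log D` is close to `log E[D]` off a small event. The center of concentration
is `K = log E[exp F]`, so that `E[D] ≤ exp K` is immediate, while the lower bound for `E[D]` holds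
because `D` is at least `exp (K - 2 * t)` with probability at least `1 / 2`. -/
theorem meas_logDeviation_le {Ω : Type*} [MeasurableSpace Ω] {P : Measure Ω}
    [IsProbabilityMeasure P] {D F : Ω → ℝ} (hD : AEMeasurable D P) (hF : AEMeasurable F P)
    (hDF : ∀ ω, D ω ≤ Real.exp (F ω)) {V t : ℝ}
    (hmom : (∫⁻ ω, ENNReal.ofReal (Real.exp (F ω)) ∂P) *
      ∫⁻ ω, ENNReal.ofReal (Real.exp (-F ω)) ∂P ≤ ENNReal.ofReal (Real.exp V))
    {Bad : Set Ω} (hBad : ∀ ω ∉ Bad, Real.exp (F ω - t) ≤ D ω) (ht : Real.log 2 ≤ t)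
    (hhalf : P Bad + ENNReal.ofReal (Real.exp (-t)) + ENNReal.ofReal (Real.exp (V - t)) ≤ 1 / 2) :
    P {ω | ENNReal.ofReal (4 * t) <
      (extLog (D ω) - ENNReal.log (∫⁻ ω, ENNReal.ofReal (D ω) ∂P)).abs} ≤
      P Bad + ENNReal.ofReal (Real.exp (-t)) + ENNReal.ofReal (Real.exp (V - t)) := by
  have hexpF : AEMeasurable (fun ω => ENNReal.ofReal (Real.exp (F ω))) P := by fun_prop
  have hexpF' : AEMeasurable (fun ω => ENNReal.ofReal (Real.exp (-F ω))) P := by fun_prop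
  set a := ∫⁻ ω, ENNReal.ofReal (Real.exp (F ω)) ∂P with ha
  set a' := ∫⁻ ω, ENNReal.ofReal (Real.exp (-F ω)) ∂P with ha'
  have ha0 : a ≠ 0 := by
    rw [ha, Ne, lintegral_eq_zero_iff' hexpF]
    intro h
    obtain ⟨ω, hω⟩ := h.exists
    simp [not_le.2 (Real.exp_pos _)] at hω
  have ha0' : a' ≠ 0 := by
    rw [ha', Ne, lintegral_eq_zero_iff' hexpF']
    intro h
    obtain ⟨ω, hω⟩ := h.exists
    simp [not_le.2 (Real.exp_pos _)] at hω
  have hat : a ≠ ⊤ := by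
    intro h
    rw [h, ENNReal.top_mul ha0'] at hmom
    exact absurd hmom (by simp)
  obtain ⟨K, hK⟩ : ∃ K : ℝ, a = ENNReal.ofReal (Real.exp K) := by
    refine ⟨Real.log a.toReal, ?_⟩
    rw [Real.exp_log (ENNReal.toReal_pos ha0 hat), ENNReal.ofReal_toReal hat]
  have hpos : ∀ r : ℝ, ENNReal.ofReal (Real.exp r) ≠ 0 := fun r => by
    simpa using Real.exp_pos r
  -- `U₁` is the event `F ≥ K + t` and `U₂` the event `F ≤ K - t`.
  set U₁ := {ω | ENNReal.ofReal (Real.exp (K + t)) ≤ ENNReal.ofReal (Real.exp (F ω))} with hU₁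
  set U₂ := {ω | ENNReal.ofReal (Real.exp (t - K)) ≤ ENNReal.ofReal (Real.exp (-F ω))} with hU₂
  have hdiv : ∀ r s : ℝ, ENNReal.ofReal (Real.exp r) / ENNReal.ofReal (Real.exp s) =
      ENNReal.ofReal (Real.exp (r - s)) := fun r s => by
    rw [← ENNReal.ofReal_div_of_pos (Real.exp_pos s), Real.exp_sub]
  have hP1 : P U₁ ≤ ENNReal.ofReal (Real.exp (-t)) := by
    refine (meas_ge_le_lintegral_div hexpF (hpos _) ENNReal.ofReal_ne_top).trans_eq ?_
    rw [← ha, hK, hdiv]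
    congr 2
    ring
  have hP2 : P U₂ ≤ ENNReal.ofReal (Real.exp (V - t)) := by
    refine (meas_ge_le_lintegral_div hexpF' (hpos _) ENNReal.ofReal_ne_top).trans ?_
    have h1 : a' ≤ ENNReal.ofReal (Real.exp (V - K)) := by
      rw [← hdiv, ENNReal.le_div_iff_mul_le (Or.inl (hpos K)) (Or.inl ENNReal.ofReal_ne_top),
        mul_comm, ← hK]
      exact hmom
    calc a' / _ ≤ ENNReal.ofReal (Real.exp (V - K)) / ENNReal.ofReal (Real.exp (t - K)) := by
          gcongr
      _ = _ := by
          rw [hdiv]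
          congr 2
          ring
  set N := Bad ∪ U₁ ∪ U₂ with hN
  have hPN : P N ≤ P Bad + ENNReal.ofReal (Real.exp (-t)) + ENNReal.ofReal (Real.exp (V - t)) :=
    (measure_union_le _ _).trans (add_le_add ((measure_union_le _ _).trans
      (add_le_add le_rfl hP1)) hP2)
  have hgood : ∀ ω ∉ N, Real.exp (K - 2 * t) ≤ D ω ∧ D ω ≤ Real.exp (K + t) := by
    intro ω hω
    simp only [hN, Set.mem_union, not_or] at hω
    obtain ⟨⟨h1, h2⟩, h3⟩ := hω
    simp only [hU₁, hU₂, Set.mem_ofPred_eq, not_le] at h2 h3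
    have h2' := Real.exp_lt_exp.1 ((ENNReal.ofReal_lt_ofReal_iff (Real.exp_pos _)).1 h2)
    have h3' := Real.exp_lt_exp.1 ((ENNReal.ofReal_lt_ofReal_iff (Real.exp_pos _)).1 h3)
    exact ⟨(Real.exp_le_exp.2 (by linarith)).trans (hBad ω h1),
      (hDF ω).trans (Real.exp_le_exp.2 h2'.le)⟩
  set E := ∫⁻ ω, ENNReal.ofReal (D ω) ∂P with hE
  have hEa : E ≤ ENNReal.ofReal (Real.exp K) := by
    rw [← hK]
    exact lintegral_mono fun ω => ENNReal.ofReal_le_ofReal (hDF ω)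
  have hElow : ENNReal.ofReal (Real.exp (K - 2 * t - Real.log 2)) ≤ E := by
    set S := {ω | ENNReal.ofReal (Real.exp (K - 2 * t)) ≤ ENNReal.ofReal (D ω)} with hS
    have hS2 : 1 / 2 ≤ P S := by
      have hcov : (1 : ENNReal) ≤ P S + 1 / 2 := by
        calc (1 : ENNReal) = P Set.univ := measure_univ.symm
          _ ≤ P (S ∪ N) := measure_mono fun ω _ => by
              by_cases h : ω ∈ N
              · exact Or.inr h
              · exact Or.inl (ENNReal.ofReal_le_ofReal (hgood ω h).1)
          _ ≤ P S + P N := measure_union_le _ _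
          _ ≤ P S + 1 / 2 := by gcongr; exact hPN.trans hhalf
      have h2 : (1 / 2 : ENNReal) + 1 / 2 ≤ P S + 1 / 2 := by
        rwa [ENNReal.add_halves]
      exact (ENNReal.add_le_add_iff_right (by simp)).1 h2
    calc ENNReal.ofReal (Real.exp (K - 2 * t - Real.log 2))
        = ENNReal.ofReal (Real.exp (K - 2 * t)) * (1 / 2) := by
          rw [Real.exp_sub, Real.exp_log two_pos, ENNReal.ofReal_div_of_pos two_pos,
            ENNReal.ofReal_ofNat, mul_one_div]
      _ ≤ ENNReal.ofReal (Real.exp (K - 2 * t)) * P S := by gcongr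
      _ ≤ E := mul_meas_ge_le_lintegral₀ hD.ennreal_ofReal _
  have hE0 : E ≠ 0 := fun h => hpos _ (le_antisymm (h ▸ hElow) bot_le)
  have hEt : E ≠ ⊤ := ne_top_of_le_ne_top ENNReal.ofReal_ne_top hEa
  have hEr : 0 < E.toReal := ENNReal.toReal_pos hE0 hEt
  have hElog : ENNReal.log E = Real.log E.toReal := ENNReal.log_pos_real hE0 hEt
  have hEup : Real.log E.toReal ≤ K := by
    rw [Real.log_le_iff_le_exp hEr]
    exact ENNReal.toReal_le_of_le_ofReal (Real.exp_nonneg _) hEa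
  have hElo : K - 2 * t - Real.log 2 ≤ Real.log E.toReal := by
    rw [Real.le_log_iff_exp_le hEr]
    exact (ENNReal.ofReal_le_iff_le_toReal hEt).1 hElow
  -- Off `N`, `log D` lies in `[K - 2t, K + t]` and `log E[D]` in `[K - 2t - log 2, K]`,
  -- and `log 2 ≤ t`.
  refine (measure_mono ?_).trans hPN
  intro ω hω
  by_contra hωN
  obtain ⟨h1, h2⟩ := hgood ω hωN
  have hDpos : 0 < D ω := (Real.exp_pos _).trans_le h1
  have h1' := (Real.le_log_iff_exp_le hDpos).2 h1
  have h2' := (Real.log_le_iff_le_exp hDpos).2 h2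
  simp only [Set.mem_ofPred_eq] at hω
  rw [extLog_of_pos hDpos, hElog, ← EReal.coe_sub, EReal.abs_def] at hω
  refine absurd hω (not_lt.2 (ENNReal.ofReal_le_ofReal (abs_le.2 ⟨?_, ?_⟩)))
  · have := Real.log_nonneg one_le_two
    linarith
  · linarith

theorem lt_of_lt_inv_mul_coe {δ s : ℝ} (hδ : 0 ≤ δ) (hs : 0 < s) {v : ENNReal}
    (h : (δ : EReal) < ((1 / s : ℝ) : EReal) * (v : EReal)) : ENNReal.ofReal (δ * s) < v := by
  by_contra hv
  rw [not_lt] at hv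
  have hvt : v ≠ ⊤ := ne_top_of_le_ne_top ENNReal.ofReal_ne_top hv
  lift v to NNReal using hvt
  have h1 : ((v : ENNReal) : EReal) = ((v : ℝ) : EReal) := rfl
  rw [h1, ← EReal.coe_mul, EReal.coe_lt_coe_iff, one_div_mul_eq_div, lt_div_iff₀ hs] at h
  exact absurd ((ENNReal.ofReal_lt_coe_iff (by positivity)).2 h) (not_lt.2 hv)

theorem le_mul_of_inv_mul_le {δ s : ℝ} (hs : 0 < s) {u : EReal}
    (h : ((1 / s : ℝ) : EReal) * u ≤ (δ : EReal)) : u ≤ ((δ * s : ℝ) : EReal) := by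
  induction u with
  | bot => exact bot_le
  | top =>
    rw [EReal.coe_mul_top_of_pos (by positivity)] at h
    exact absurd h (by simp)
  | coe u =>
    rw [← EReal.coe_mul, EReal.coe_le_coe_iff, one_div_mul_eq_div, div_le_iff₀ hs] at h
    exact_mod_cast h

/-- The moment bound `c / ε n` is negligible against `s n`; since `ε n ≤ 1` eventually, the
divergence of `s n * ε n ^ 2` is more than enough. -/
theorem tendsto_const_div_sub_mul_atBot {ε s : ℕ → ℝ} (hε : ∀ᶠ n in atTop, 0 < ε n)
    (hε0 : Tendsto ε atTop (𝓝 0)) (hsε : Tendsto (fun n => s n * ε n ^ 2) atTop atTop)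
    (c : ℝ) {κ : ℝ} (hκ : 0 < κ) :
    Tendsto (fun n => c / ε n - κ * s n) atTop atBot := by
  have h1 : Tendsto (fun n => c - κ * (s n * ε n ^ 2)) atTop atBot := by
    simpa [sub_eq_add_neg] using tendsto_atBot_add_const_left atTop c
      (tendsto_neg_atTop_atBot.comp (hsε.const_mul_atTop hκ))
  refine tendsto_atBot_mono' atTop ?_ h1
  filter_upwards [hε, hε0.eventually_le_const one_pos, h1.eventually_le_atBot 0,
    hsε.eventually_ge_atTop 0] with n h0 hle h2 h3
  have hs : 0 ≤ s n := nonneg_of_mul_nonneg_left h3 (by positivity)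
  have h4 : c / ε n - κ * s n = (c - κ * (s n * ε n)) / ε n := by field_simp
  have h5 : c - κ * (s n * ε n) ≤ c - κ * (s n * ε n ^ 2) := by
    have : s n * ε n ^ 2 ≤ s n * ε n := mul_le_mul_of_nonneg_left (by nlinarith) hs
    nlinarith
  rw [h4]
  refine (div_le_iff₀ h0).2 (h5.trans ?_)
  nlinarith

end PermanentEstimator

theorem proposition2p1 {Ω : Type*} [MeasurableSpace Ω] (P : Measure Ω) [IsProbabilityMeasure P]
    (x : ℕ → ℕ → Ω → ℝ)
    (hlaw : ∀ i j, HasLaw (x i j) (gaussianReal 0 1) P)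
    (hindep : iIndepFun (fun (p : ℕ × ℕ) => x p.1 p.2) P)
    (b : ℝ)
    (𝒜 : (n m : ℕ) → Set (Matrix (Fin n) (Fin m) ℝ))
    (h𝒜 : ∀ n m, 𝒜 n m ⊆ PermanentEstimator.matrixClass n m (Set.Icc 0 b))
    (ε s : ℕ → ℝ)
    (hcond : PermanentEstimator.SmallEigCondition P x 𝒜 ε s)
    (δ : ℝ) (hδ : 0 < δ) :
    Tendsto (fun n => ⨆ (m : ℕ) (A ∈ 𝒜 n m),
      P {ω | (δ : EReal) < ((1 / s n : ℝ) : EReal) *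
        ((PermanentEstimator.logDetDeviation P x A ω : ENNReal) : EReal)}) atTop (𝓝 0) := by
  open PermanentEstimator in
  obtain ⟨hε, hε0, hs, hsε, hlim⟩ := hcond
  -- The concentration estimate loses a factor `4`, so it is used at the scale `δ / 4 * s n`.
  have hδ4 : 0 < δ / 4 := by positivity
  set p : ℕ → ENNReal := fun n => ⨆ (m : ℕ) (A ∈ 𝒜 n m), P {ω | ((δ / 4 : ℝ) : EReal) <
    ((1 / s n : ℝ) : EReal) * smallEigSum (fun i j => x i j ω) A (ε n)} with hp
  have hp0 : Tendsto p atTop (𝓝 0) :=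
    tendsto_of_le_liminf_of_limsup_le bot_le (hlim (δ / 4) hδ4).le
  have hexp : ∀ u : ℕ → ℝ, Tendsto u atTop atBot →
      Tendsto (fun n => ENNReal.ofReal (Real.exp (u n))) atTop (𝓝 0) := fun u hu => by
    simpa using ENNReal.tendsto_ofReal (Real.tendsto_exp_atBot.comp hu)
  have hE1 := hexp (fun n => -(δ / 4 * s n))
    (tendsto_neg_atTop_atBot.comp (hs.const_mul_atTop hδ4))
  have hE2 := hexp (fun n => 4 * |b| / ε n - δ / 4 * s n)
    (tendsto_const_div_sub_mul_atBot hε hε0 hsε _ hδ4)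
  have htot := (hp0.add hE1).add hE2
  simp only [add_zero] at htot
  refine tendsto_of_tendsto_of_tendsto_of_le_of_le' tendsto_const_nhds htot
    (Eventually.of_forall fun _ => bot_le) ?_
  filter_upwards [hε, hε0.eventually_le_const one_pos, hs.eventually_gt_atTop 0,
    (hs.const_mul_atTop hδ4).eventually_ge_atTop (Real.log 2),
    htot.eventually_le_const (show (0 : ENNReal) < 1 / 2 by simp)] with n hε1 hε2 hs1 ht hhalf
  refine iSup_le fun m => iSup₂_le fun A hA => ?_
  obtain ⟨hFm, hmom⟩ := truncLogDet_exp_moment hlaw hindep hε1 (h𝒜 n m hA)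
  set Bad : Set Ω := {ω | ((δ / 4 : ℝ) : EReal) <
    ((1 / s n : ℝ) : EReal) * smallEigSum (fun i j => x i j ω) A (ε n)} with hBad
  have hBadp : P Bad ≤ p n :=
    le_iSup_of_le (f := fun m => ⨆ A ∈ 𝒜 n m, P {ω | ((δ / 4 : ℝ) : EReal) <
      ((1 / s n : ℝ) : EReal) * smallEigSum (fun i j => x i j ω) A (ε n)}) m
      (le_iSup₂_of_le A hA le_rfl)
  have hle : P Bad + ENNReal.ofReal (Real.exp (-(δ / 4 * s n))) +
      ENNReal.ofReal (Real.exp (4 * |b| / ε n - δ / 4 * s n)) ≤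
      p n + ENNReal.ofReal (Real.exp (-(δ / 4 * s n))) +
      ENNReal.ofReal (Real.exp (4 * |b| / ε n - δ / 4 * s n)) := by gcongr
  refine (measure_mono ?_).trans ((meas_logDeviation_le (aemeasurable_det_matZ hlaw (rescale A))
    hFm (fun ω => det_le_exp_truncLogDet hε1 _) hmom (Bad := Bad) (t := δ / 4 * s n)
    (fun ω hω => exp_truncLogDet_sub_le_det hε1 hε2
      (le_mul_of_inv_mul_le hs1 (not_lt.1 hω))) ht (hle.trans hhalf)).trans hle)
  intro ω hω
  have := lt_of_lt_inv_mul_coe hδ.le hs1 hω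
  rwa [show 4 * (δ / 4 * s n) = δ * s n by ring]
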